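/- Let $\varepsilon>0$ and $A>0$, let $H$ be the sign function on $\mathbb{R}$, and let $K'(x)=-\frac{A}{2}H(x)+V(x)$, where $V\in W^{1,1}(\mathbb{R})$ has weak derivative $V_x$ with $\|V_x\|_{L^1(\mathbb{R})}<A$. Let $u_0\in L^1(\mathbb{R})$ be nonnegative, and let $$u\in C([0,\infty),L^1(\mathbb{R}))\cap C((0,\infty),W^{1,1}(\mathbb{R}))\cap C^1((0,\infty),L^1(\mathbb{R}))$$ be a nonnegative solution of $$u_t=\varepsilon u_{xx}+\bigl(u\,(K'*u)\bigr)_x\quad(x\in\mathbb{R},\ t>0),\qquad u(\cdot,0)=u_0,$$ where for every $t>0$ the equation holds in the sense of distributions in $x$ and $(K'*u)(x,t)=\int_{\mathbb{R}}K'(x-y)\,u(y,t)\,dy$. Then for every $p\in[1,\infty]$ and every $t>0$, $$\|u(\cdot,t)\|_{p}\le\bigl(A-\|V_x\|_1\bigr)^{\frac{1-p}{p}}\,\|u_0\|_1^{1/p}\,t^{\frac{1-p}{p}},$$ where for $p=\infty$ the estimate reads $\|u(\cdot,t)\|_\infty\le (A-\|V_x\|_1)^{-1}t^{-1}$. -/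

import Mathlib

open MeasureTheory
open scoped ContDiff ENNReal

noncomputable section

/-- The space `L¹(ℝ)` with respect to Lebesgue measure. -/
abbrev L1 : Type := Lp ℝ 1 (volume : Measure ℝ)

/-- `φ ∈ C_c^∞(ℝ)`. -/
def IsTestFunction (φ : ℝ → ℝ) : Prop :=
  ContDiff ℝ ∞ φ ∧ HasCompactSupport φ

/-- `g` is the weak (distributional) derivative on `ℝ` of the locally integrable function `f`.
Thus `f ∈ W^{1,1}(ℝ)` exactly if `f ∈ L¹(ℝ)` has a weak derivative in `L¹(ℝ)`. -/
def HasWeakDeriv (f g : ℝ → ℝ) : Prop :=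
  LocallyIntegrable f volume ∧ LocallyIntegrable g volume ∧
    ∀ φ : ℝ → ℝ, IsTestFunction φ → ∫ x, f x * deriv φ x = -∫ x, g x * φ x

/-- The interaction kernel `K'(x) = -(A/2) H(x) + V(x)`, with `H` the sign function. -/
def interactionKernel (A : ℝ) (V : ℝ → ℝ) : ℝ → ℝ :=
  fun x => -(A / 2) * Real.sign x + V x

/-- The convolution `(f * g)(x) = ∫ f(x - y) g(y) dy` on `ℝ`. -/
def convolve (f g : ℝ → ℝ) : ℝ → ℝ :=
  fun x => ∫ y, f (x - y) * g y

/-- `u` is a global-in-time solution of `u_t = ε u_xx + (u (K' * u))_x`, `u(0) = u₀`, in the class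
`C([0,∞), L¹(ℝ)) ∩ C((0,∞), W^{1,1}(ℝ)) ∩ C¹((0,∞), L¹(ℝ))`.
At every time `t > 0` the equation holds in the sense of distributions in `x`,
where `u_t(t)` is the derivative of the curve `u` in `L¹(ℝ)`. -/
structure IsAggregationSolution (ε : ℝ) (K' : ℝ → ℝ) (u₀ : L1) (u : ℝ → L1) : Prop where
  continuous_L1 : ContinuousOn u (Set.Ici 0)
  continuous_W11 : ∃ ux : ℝ → L1, ContinuousOn ux (Set.Ioi 0) ∧
    ∀ t : ℝ, 0 < t → HasWeakDeriv (u t) (ux t)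
  contDiff_L1 : ContDiffOn ℝ 1 u (Set.Ioi 0)
  initial : u 0 = u₀
  equation : ∀ t : ℝ, 0 < t → ∀ φ : ℝ → ℝ, IsTestFunction φ →
    ∫ x, (deriv u t : L1) x * φ x =
      ε * (∫ x, u t x * deriv (deriv φ) x) - ∫ x, (u t x * convolve K' (u t) x) * deriv φ x

end

/-!
The case `p = ∞` carries everything: the mass `∫ u` is at most `‖u₀‖₁`, and interpolation between
`L¹` and `L^∞` (`eLpNorm_le_of_integral_le_of_ae_le`) turns `u ≤ ((A - ‖V_x‖₁) t)⁻¹` into the stated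
bound for every finite `p`.

The pointwise bound comes from integer powers. The jump of the sign function makes the velocity
`K' * u` absolutely continuous with derivative `-A u + V_x * u`
(`isPrimitive_convolve_interactionKernel`). Two integrations by parts and Young's inequality for the
nonlocal part give, with `c = A - ‖V_x‖₁`,
`d/dt ∫ u ^ (n + 1) ≤ -n c ∫ u ^ (n + 2)`
(`mul_integral_pow_mul_timeDeriv_le`); the diffusion only helps. No regularity beyond the given
class is needed, because the equation says that the flux `ε u_x + u (K' * u)`, an `L¹` function, has the
`L¹` function `u_t` as weak derivative, and a `W^{1,1}` function is the primitive of its weak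
derivative (`HasWeakDeriv.ae_eq_integral`).

Fix `t₀ > 0` and put `τ = t - t₀`. By Young's inequality `(n + 1) w ^ n ≤ n w ^ (n + 1) + 1` with
`w = c τ u`, the derivative of `c ^ n τ ^ (n + 1) ∫ u ^ (n + 1)` is at most the mass, whence
`∫ u (c τ u) ^ n ≤ ‖u₀‖₁` (`pow_mul_integral_pow_le`). As this holds for all `n`, `c τ u ≤ 1`
(`mul_le_one_of_integral_pow_le`), and `t₀ → 0` gives the claim. The shift by `t₀` is needed since
`u` is only an `L¹` function at time `0`, with no control of its powers.
-/

open Filter Topology Set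
open scoped BoundedContinuousFunction

/-! ### Absolutely continuous functions given as primitives -/

/-- `F` is the absolutely continuous function on `ℝ` with integrable derivative `g` and limit `c`
at `-∞`. Every element of `W^{1,1}(ℝ)` has such a representative, with `c = 0`; nonzero `c` is
allowed because the velocity `K' * u` does not vanish at `-∞`. -/
structure IsPrimitive (F g : ℝ → ℝ) (c : ℝ) : Prop where
  integrable : Integrable g
  eq_add_integral : ∀ x, F x = c + ∫ y in Iic x, g y

namespace IsPrimitive

variable {F G f g : ℝ → ℝ} {c d : ℝ}

theorem abs_le (hF : IsPrimitive F f c) (x : ℝ) : |F x| ≤ |c| + ∫ y, |f y| := by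
  rw [hF.eq_add_integral x]
  refine (abs_add_le _ _).trans (add_le_add le_rfl ?_)
  refine (abs_integral_le_integral_abs).trans ?_
  exact setIntegral_le_integral hF.integrable.abs (ae_of_all _ fun _ => abs_nonneg _)

theorem eq_add_intervalIntegral (hF : IsPrimitive F f c) (a x : ℝ) :
    F x = F a + ∫ y in a..x, f y := by
  rw [hF.eq_add_integral x, hF.eq_add_integral a,
    ← intervalIntegral.integral_Iic_sub_Iic hF.integrable.integrableOn hF.integrable.integrableOn]
  ring

theorem continuous (hF : IsPrimitive F f c) : Continuous F := by
  have h : F = fun x => F 0 + ∫ y in (0 : ℝ)..x, f y := funext (hF.eq_add_intervalIntegral 0)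
  rw [h]
  exact continuous_const.add (hF.integrable.continuous_primitive 0)

theorem tendsto_atBot (hF : IsPrimitive F f c) : Tendsto F atBot (𝓝 c) := by
  have h : F = fun x => c + ∫ y in Iic x, f y := funext hF.eq_add_integral
  rw [h]
  simpa using tendsto_const_nhds.add (tendsto_integral_Iic_zero (f := f) (μ := volume) tendsto_id)

theorem tendsto_atTop (hF : IsPrimitive F f c) : Tendsto F atTop (𝓝 (c + ∫ y, f y)) := by
  have h : F = fun x => c + ∫ y in Iic x, f y := funext hF.eq_add_integral
  rw [h]
  exact tendsto_const_nhds.add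
    ((aecover_Iic tendsto_id).integral_tendsto_of_countably_generated hF.integrable)

theorem eq_zero_of_integrable (hF : IsPrimitive F f c) (h : Integrable F) : c = 0 := by
  refine IntegrableAtFilter.eq_zero_of_tendsto (μ := volume) (l := atBot)
    (h.integrableAtFilter _) (fun s hs => ?_) hF.tendsto_atBot
  obtain ⟨a, ha⟩ := mem_atBot_sets.1 hs
  exact top_unique ((Real.volume_Iic (a := a)).symm.le.trans (measure_mono ha))

theorem integral_eq_zero_of_integrable (hF : IsPrimitive F f c) (h : Integrable F) :
    ∫ x, f x = 0 := by
  have : c + ∫ x, f x = 0 := by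
    refine IntegrableAtFilter.eq_zero_of_tendsto (μ := volume) (l := atTop)
      (h.integrableAtFilter _) (fun s hs => ?_) hF.tendsto_atTop
    obtain ⟨a, ha⟩ := mem_atTop_sets.1 hs
    exact top_unique ((Real.volume_Ici (a := a)).symm.le.trans (measure_mono ha))
  rwa [hF.eq_zero_of_integrable h, zero_add] at this

theorem integrable_mul (hF : IsPrimitive F f c) (hg : Integrable g) :
    Integrable (fun x => F x * g x) :=
  hg.bdd_mul hF.continuous.aestronglyMeasurable (ae_of_all _ hF.abs_le)

theorem integrable_mul' (hF : IsPrimitive F f c) (hg : Integrable g) :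
    Integrable (fun x => g x * F x) := by
  simpa only [mul_comm] using hF.integrable_mul hg

theorem add (hF : IsPrimitive F f c) (hG : IsPrimitive G g d) :
    IsPrimitive (fun x => F x + G x) (fun x => f x + g x) (c + d) where
  integrable := hF.integrable.add hG.integrable
  eq_add_integral x := by
    rw [hF.eq_add_integral, hG.eq_add_integral,
      integral_add hF.integrable.integrableOn hG.integrable.integrableOn]
    ring

theorem const (k : ℝ) : IsPrimitive (fun _ => k) (fun _ => 0) k where
  integrable := integrable_zero _ _ _
  eq_add_integral x := by simp

end IsPrimitive

theorem isPrimitive_integral_Iic {f : ℝ → ℝ} (hf : Integrable f) :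
    IsPrimitive (fun x => ∫ y in Iic x, f y) f 0 where
  integrable := hf
  eq_add_integral x := by simp

/-- The product rule for two primitives that vanish at `-∞`. It is Fubini's theorem on the square
`(-∞, x]²`, cut along the diagonal. -/
theorem integral_Iic_mul_integral_Iic {f g : ℝ → ℝ} (hf : Integrable f) (hg : Integrable g)
    (x : ℝ) :
    (∫ y in Iic x, f y) * (∫ y in Iic x, g y) =
      ∫ y in Iic x, (f y * (∫ z in Iic y, g z) + (∫ z in Iic y, f z) * g y) := by
  set ν := (volume : Measure ℝ).restrict (Iic x) with hν
  have hfg : Integrable (fun z : ℝ × ℝ => f z.1 * g z.2) (ν.prod ν) :=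
    Integrable.mul_prod hf.integrableOn hg.integrableOn
  have hS : MeasurableSet {z : ℝ × ℝ | z.2 ≤ z.1} := measurableSet_le measurable_snd measurable_fst
  have h1 : ∫ z in {z : ℝ × ℝ | z.2 ≤ z.1}, f z.1 * g z.2 ∂(ν.prod ν) =
      ∫ s in Iic x, f s * ∫ t in Iic s, g t := by
    rw [← integral_indicator hS, integral_prod _ (hfg.indicator hS)]
    refine setIntegral_congr_fun measurableSet_Iic fun s hs => ?_
    have : ∀ t, indicator {z : ℝ × ℝ | z.2 ≤ z.1} (fun z => f z.1 * g z.2) (s, t) =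
        indicator (Iic s) (fun t => f s * g t) t := fun t => by simp [indicator]
    simp only [this]
    rw [integral_indicator measurableSet_Iic, hν, Measure.restrict_restrict measurableSet_Iic,
      inter_eq_left.2 (Iic_subset_Iic.2 hs), integral_const_mul]
  have h2 : ∫ z in {z : ℝ × ℝ | z.2 ≤ z.1}ᶜ, f z.1 * g z.2 ∂(ν.prod ν) =
      ∫ t in Iic x, (∫ s in Iic t, f s) * g t := by
    rw [← integral_indicator hS.compl, integral_prod_symm _ (hfg.indicator hS.compl)]
    refine setIntegral_congr_fun measurableSet_Iic fun t ht => ?_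
    have : ∀ s, indicator {z : ℝ × ℝ | z.2 ≤ z.1}ᶜ (fun z => f z.1 * g z.2) (s, t) =
        indicator (Iio t) (fun s => f s * g t) s := fun s => by simp [indicator]
    simp only [this]
    rw [integral_indicator measurableSet_Iio, hν, Measure.restrict_restrict measurableSet_Iio,
      inter_eq_left.2 (Iio_subset_Iic_self.trans (Iic_subset_Iic.2 ht)), integral_mul_const,
      integral_Iic_eq_integral_Iio]
  rw [← integral_prod_mul, ← integral_add_compl hS hfg, h1, h2, integral_add]
  · exact ((isPrimitive_integral_Iic hg).integrable_mul' hf).integrableOn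
  · exact ((isPrimitive_integral_Iic hf).integrable_mul hg).integrableOn

namespace IsPrimitive

variable {F G f g : ℝ → ℝ} {c d : ℝ}

theorem mul (hF : IsPrimitive F f c) (hG : IsPrimitive G g d) :
    IsPrimitive (fun x => F x * G x) (fun x => f x * G x + F x * g x) (c * d) where
  integrable := (hG.integrable_mul' hF.integrable).add (hF.integrable_mul hG.integrable)
  eq_add_integral x := by
    have hP := isPrimitive_integral_Iic hF.integrable
    have hQ := isPrimitive_integral_Iic hG.integrable
    have key := integral_Iic_mul_integral_Iic hF.integrable hG.integrable x
    have e : ∀ y, f y * G y + F y * g y =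
        (f y * (∫ z in Iic y, g z) + (∫ z in Iic y, f z) * g y) + (d * f y + c * g y) := by
      intro y
      rw [hF.eq_add_integral y, hG.eq_add_integral y]
      ring
    simp only [e]
    rw [integral_add, ← key, integral_add, integral_const_mul, integral_const_mul,
      hF.eq_add_integral x, hG.eq_add_integral x]
    · ring
    · exact (hF.integrable.const_mul d).integrableOn
    · exact (hG.integrable.const_mul c).integrableOn
    · exact ((hQ.integrable_mul' hF.integrable).add (hP.integrable_mul hG.integrable)).integrableOn
    · exact ((hF.integrable.const_mul d).add (hG.integrable.const_mul c)).integrableOn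

theorem pow_succ (hF : IsPrimitive F f 0) (n : ℕ) :
    IsPrimitive (fun x => F x ^ (n + 1)) (fun x => (n + 1) * (F x ^ n * f x)) 0 := by
  induction n with
  | zero => simpa using hF
  | succ n ih =>
    have h := ih.mul hF
    simp only [mul_zero, ← _root_.pow_succ] at h
    convert h using 2 with x
    push_cast
    ring

/-- Integration by parts on the whole line, without boundary terms because the product is
integrable. -/
theorem integral_mul_eq_neg (hF : IsPrimitive F f c) (hG : IsPrimitive G g d)
    (h : Integrable fun x => F x * G x) :
    ∫ x, F x * g x = -∫ x, f x * G x := by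
  have h0 := (hF.mul hG).integral_eq_zero_of_integrable h
  rw [integral_add (hG.integrable_mul' hF.integrable) (hF.integrable_mul hG.integrable)] at h0
  linarith

end IsPrimitive

/-! ### Weak derivatives and absolutely continuous representatives -/

theorem IsTestFunction.integrable {φ : ℝ → ℝ} (h : IsTestFunction φ) : Integrable φ :=
  h.1.continuous.integrable_of_hasCompactSupport h.2

theorem IsTestFunction.deriv {φ : ℝ → ℝ} (h : IsTestFunction φ) : IsTestFunction (deriv φ) :=
  ⟨(contDiff_infty_iff_deriv.1 h.1).2, h.2.deriv⟩

theorem IsTestFunction.isPrimitive {φ : ℝ → ℝ} (h : IsTestFunction φ) :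
    IsPrimitive φ (_root_.deriv φ) 0 where
  integrable := h.deriv.integrable
  eq_add_integral x := by
    rw [h.2.integral_Iic_deriv_eq (h.1.of_le (by exact_mod_cast le_top)), zero_add]

/-- A test function of vanishing integral is the derivative of a test function. -/
theorem IsTestFunction.exists_deriv_eq {φ : ℝ → ℝ} (h : IsTestFunction φ) (h0 : ∫ x, φ x = 0) :
    ∃ ψ, IsTestFunction ψ ∧ _root_.deriv ψ = φ := by
  have hp := isPrimitive_integral_Iic h.integrable
  set ψ : ℝ → ℝ := fun x => ∫ y in Iic x, φ y with hψ
  have hd : ∀ x, HasDerivAt ψ (φ x) x := by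
    intro x
    have e : ψ = fun x => ψ 0 + ∫ y in (0 : ℝ)..x, φ y := funext (hp.eq_add_intervalIntegral 0)
    rw [e]
    exact (intervalIntegral.integral_hasDerivAt_right (h.1.continuous.intervalIntegrable _ _)
      (h.1.continuous.stronglyMeasurableAtFilter _ _) h.1.continuous.continuousAt).const_add _
  have hde : _root_.deriv ψ = φ := funext fun x => (hd x).deriv
  refine ⟨ψ, ⟨contDiff_infty_iff_deriv.2 ⟨fun x => (hd x).differentiableAt, hde ▸ h.1⟩, ?_⟩, hde⟩
  obtain ⟨R, hR⟩ := h.2.isBounded.subset_closedBall (0 : ℝ)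
  have hz : ∀ y, y ∉ Icc (-R) R → φ y = 0 := fun y hy => by
    by_contra hne
    have := hR (subset_tsupport _ hne)
    rw [Real.closedBall_eq_Icc] at this
    exact hy (by simpa using this)
  refine HasCompactSupport.intro (isCompact_Icc (a := -R) (b := R)) fun x hx => ?_
  rcases lt_or_ge x (-R) with hlt | hge
  · refine setIntegral_eq_zero_of_forall_eq_zero fun y hy => hz y fun hy' => ?_
    have := mem_Iic.1 hy
    linarith [hy'.1]
  · have hgt : R < x := by
      by_contra hle
      exact hx ⟨hge, not_lt.1 hle⟩
    rw [hψ, ← h0]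
    refine setIntegral_eq_integral_of_forall_compl_eq_zero fun y hy => hz y fun hy' => ?_
    have := not_le.1 (mt mem_Iic.2 hy)
    linarith [hy'.2]

/-- The du Bois-Reymond lemma: a function whose weak derivative vanishes is constant. -/
theorem exists_ae_eq_const_of_integral_mul_deriv_eq_zero {f : ℝ → ℝ}
    (hf : LocallyIntegrable f volume)
    (h : ∀ φ, IsTestFunction φ → ∫ x, f x * deriv φ x = 0) :
    ∃ k : ℝ, ∀ᵐ x, f x = k := by
  let b : ContDiffBump (0 : ℝ) := default
  have hη : IsTestFunction (b.normed volume) := ⟨b.contDiff_normed, b.hasCompactSupport_normed⟩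
  have hη1 : ∫ x, b.normed volume x = 1 := b.integral_normed
  set η := b.normed (volume : Measure ℝ)
  have hint : ∀ φ, IsTestFunction φ → Integrable fun x => f x * φ x := fun φ hφ => by
    simpa [mul_comm] using hf.integrable_smul_left_of_hasCompactSupport hφ.1.continuous hφ.2
  refine ⟨∫ x, f x * η x, ?_⟩
  refine ae_eq_of_integral_contDiff_smul_eq hf (locallyIntegrable_const _) fun φ hφ hφ' => ?_
  have hφt : IsTestFunction φ := ⟨hφ, hφ'⟩
  have hmean : IsTestFunction fun x => φ x - (∫ y, φ y) * η x :=
    ⟨hφ.sub (contDiff_const.mul hη.1), hφ'.sub hη.2.mul_left⟩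
  obtain ⟨ψ, hψ, hψd⟩ := hmean.exists_deriv_eq (by
    rw [integral_sub hφt.integrable (hη.integrable.const_mul _), integral_const_mul, hη1]
    ring)
  have h0 := h ψ hψ
  rw [hψd] at h0
  have e : ∀ x, f x * (φ x - (∫ y, φ y) * η x) = f x * φ x - (∫ y, φ y) * (f x * η x) :=
    fun x => by ring
  simp only [e] at h0
  rw [integral_sub (hint φ hφt) ((hint η hη).const_mul _), integral_const_mul] at h0
  simp only [smul_eq_mul, integral_mul_const]
  rw [← sub_eq_zero, ← h0]
  simp only [mul_comm]

/-- A `W^{1,1}` function has the primitive of its weak derivative as representative. -/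
theorem HasWeakDeriv.ae_eq_integral {f g : ℝ → ℝ} (h : HasWeakDeriv f g) (hf : Integrable f)
    (hg : Integrable g) : ∀ᵐ x, f x = ∫ y in Iic x, g y := by
  have hG := isPrimitive_integral_Iic hg
  set G : ℝ → ℝ := fun x => ∫ y in Iic x, g y
  obtain ⟨k, hk⟩ := exists_ae_eq_const_of_integral_mul_deriv_eq_zero (f := fun x => f x - G x)
    (h.1.sub hG.continuous.locallyIntegrable) fun φ hφ => by
      have hfφ : Integrable fun x => f x * deriv φ x := hφ.deriv.isPrimitive.integrable_mul' hf
      have hGφ : Integrable fun x => G x * deriv φ x := hG.integrable_mul hφ.deriv.integrable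
      simp only [sub_mul]
      rw [integral_sub hfφ hGφ, h.2.2 φ hφ,
        hG.integral_mul_eq_neg hφ.isPrimitive (hG.integrable_mul hφ.integrable), sub_self]
  have hkG : IsPrimitive (fun x => k + G x) (fun x => 0 + g x) (k + 0) :=
    (IsPrimitive.const k).add hG
  have : k = 0 := by
    have := hkG.eq_zero_of_integrable (hf.congr (hk.mono fun x hx => by linarith))
    simpa using this
  filter_upwards [hk] with x hx
  linarith

/-! ### Convolution with the interaction kernel -/

theorem integrable_convolve_integrand {v u : ℝ → ℝ} (hv : Integrable v) (hu : Integrable u) :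
    Integrable (fun p : ℝ × ℝ => v (p.1 - p.2) * u p.2) (volume.prod volume) := by
  simpa [mul_comm] using
    hu.convolution_integrand (μ := volume) (ContinuousLinearMap.mul ℝ ℝ) hv

theorem integrable_convolve {v u : ℝ → ℝ} (hv : Integrable v) (hu : Integrable u) :
    Integrable (convolve v u) :=
  (integrable_convolve_integrand hv hu).integral_prod_left

theorem convolve_congr_ae {v v' u u' : ℝ → ℝ} (hv : v =ᵐ[volume] v') (hu : u =ᵐ[volume] u') :
    convolve v u = convolve v' u' := by
  funext x
  refine integral_congr_ae ?_
  have : ∀ᵐ y, v (x - y) = v' (x - y) :=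
    (quasiMeasurePreserving_sub_left volume x).ae hv
  filter_upwards [this, hu] with y h1 h2
  rw [h1, h2]

/-- A convolution is differentiated through its first factor. -/
theorem IsPrimitive.convolve {P v u : ℝ → ℝ} (hP : IsPrimitive P v 0) (hu : Integrable u) :
    IsPrimitive (convolve P u) (convolve v u) 0 where
  integrable := integrable_convolve hP.integrable hu
  eq_add_integral x := by
    have hI := integrable_convolve_integrand hP.integrable hu
    have hI' : Integrable (fun p : ℝ × ℝ => v (p.1 - p.2) * u p.2)
        ((volume.restrict (Iic x)).prod volume) := by
      have := hI.restrict (s := Iic x ×ˢ univ)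
      rwa [← Measure.prod_restrict, Measure.restrict_univ] at this
    have hswap := integral_integral_swap (f := fun w y => v (w - y) * u y) hI'
    rw [zero_add]
    refine Eq.trans ?_ hswap.symm
    refine integral_congr_ae (ae_of_all _ fun y => ?_)
    simp only
    rw [integral_mul_const, hP.eq_add_integral, zero_add]
    congr 1
    have := (measurePreserving_sub_right (volume : Measure ℝ) y).setIntegral_preimage_emb
      (MeasurableEquiv.subRight y).measurableEmbedding v (Iic (x - y))
    rw [← this]
    congr 2
    ext w
    simp

theorem isPrimitive_convolve_sign (A : ℝ) {u : ℝ → ℝ} (hu : Integrable u) :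
    IsPrimitive (convolve (fun x => -(A / 2) * Real.sign x) u) (fun x => -A * u x)
      (A / 2 * ∫ y, u y) where
  integrable := hu.const_mul _
  eq_add_integral x := by
    have h : ∀ᵐ y, -(A / 2) * Real.sign (x - y) * u y =
        A / 2 * u y - A * (Iic x).indicator u y := by
      have hne : ∀ᵐ y : ℝ, y ≠ x := by simp [ae_iff]
      filter_upwards [hne] with y hy
      rcases lt_or_gt_of_ne hy with hlt | hgt
      · rw [Real.sign_of_pos (sub_pos.2 hlt), indicator_of_mem (mem_Iic.2 hlt.le)]
        ring
      · rw [Real.sign_of_neg (sub_neg.2 hgt), indicator_of_notMem (notMem_Iic.2 hgt)]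
        ring
    rw [_root_.convolve, integral_congr_ae h, integral_sub (hu.const_mul _)
      ((hu.indicator measurableSet_Iic).const_mul _), integral_const_mul, integral_const_mul,
      integral_indicator measurableSet_Iic, integral_const_mul]
    ring

/-- The velocity `K' * u` is absolutely continuous with derivative `-A u + V_x * u`: the jump of
the sign function at the origin contributes the local term `-A u`. -/
theorem isPrimitive_convolve_interactionKernel (A : ℝ) {V v u : ℝ → ℝ} (hV : HasWeakDeriv V v)
    (hVi : Integrable V) (hv : Integrable v) (hu : Integrable u) :
    IsPrimitive (convolve (interactionKernel A V) u) (fun x => -A * u x + convolve v u x)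
      (A / 2 * ∫ y, u y) := by
  have hP := isPrimitive_integral_Iic hv
  have h := (isPrimitive_convolve_sign A hu).add (hP.convolve hu)
  rw [add_zero] at h
  convert h using 1
  funext x
  have hK : interactionKernel A V =ᵐ[volume]
      fun x => -(A / 2) * Real.sign x + ∫ y in Iic x, v y := by
    filter_upwards [hV.ae_eq_integral hVi hv] with x hx
    rw [interactionKernel, hx]
  rw [convolve_congr_ae hK (EventuallyEq.refl _ u)]
  simp only [convolve, add_mul]
  refine integral_add ?_ ?_
  · refine hu.bdd_mul (c := |A / 2|) ?_ (ae_of_all _ fun y => ?_)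
    · have : Measurable Real.sign := by
        unfold Real.sign
        exact Measurable.ite (measurableSet_lt measurable_id measurable_const) measurable_const
          (Measurable.ite (measurableSet_lt measurable_const measurable_id) measurable_const
            measurable_const)
      exact ((this.comp (measurable_const.sub measurable_id)).const_mul _).aestronglyMeasurable
    · rw [norm_mul, Real.norm_eq_abs, Real.norm_eq_abs, abs_neg]
      refine mul_le_of_le_one_right (abs_nonneg _) ?_
      rcases Real.sign_apply_eq (x - y) with h | h | h <;> simp [h]
  · exact hu.bdd_mul
      (hP.continuous.comp (continuous_const.sub continuous_id)).aestronglyMeasurable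
      (ae_of_all _ fun y => hP.abs_le (x - y))

/-! ### Young's inequality -/

/-- Young's inequality with exponents `(n + 1) / n` and `n + 1`. -/
theorem succ_mul_pow_mul_le {a b : ℝ} (ha : 0 ≤ a) (hb : 0 ≤ b) (n : ℕ) :
    (n + 1) * (a ^ n * b) ≤ n * a ^ (n + 1) + b ^ (n + 1) := by
  induction n with
  | zero => simp
  | succ n ih =>
    have h1 := mul_le_mul_of_nonneg_left ih ha
    have h2 : 0 ≤ (a - b) * (a ^ (n + 1) - b ^ (n + 1)) := by
      rcases le_total a b with h | h
      · exact mul_nonneg_of_nonpos_of_nonpos (sub_nonpos.2 h)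
          (sub_nonpos.2 (pow_le_pow_left₀ ha h _))
      · exact mul_nonneg (sub_nonneg.2 h) (sub_nonneg.2 (pow_le_pow_left₀ hb h _))
    push_cast
    ring_nf at h1 h2 ⊢
    linarith

/-- The nonlocal part of the velocity gradient is controlled by `‖v‖₁ ∫ U ^ (n + 1)`: integrate
Young's inequality for `U x ^ n * U y` against `|v (x - y)|`. -/
theorem integral_pow_mul_convolve_le {U v : ℝ → ℝ} (hU : Integrable U) (hc : Continuous U)
    (h0 : ∀ x, 0 ≤ U x) {M : ℝ} (hM : ∀ x, U x ≤ M) (hv : Integrable v) (n : ℕ) :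
    ∫ x, U x ^ n * convolve v U x ≤ (∫ x, |v x|) * ∫ x, U x ^ (n + 1) := by
  have hpow : Integrable fun x => U x ^ (n + 1) := by
    simp only [pow_succ]
    refine hU.bdd_mul (c := M ^ n) (hc.pow n).aestronglyMeasurable (ae_of_all _ fun x => ?_)
    rw [norm_pow, Real.norm_of_nonneg (h0 x)]
    exact pow_le_pow_left₀ (h0 x) (hM x) n
  have i1 : Integrable (fun p : ℝ × ℝ => U p.1 ^ n * (v (p.1 - p.2) * U p.2))
      (volume.prod volume) := by
    refine (integrable_convolve_integrand hv hU).bdd_mul (c := M ^ n)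
      ((hc.pow n).comp continuous_fst).aestronglyMeasurable (ae_of_all _ fun p => ?_)
    rw [norm_pow, Real.norm_of_nonneg (h0 _)]
    exact pow_le_pow_left₀ (h0 _) (hM _) n
  have i2 : Integrable (fun p : ℝ × ℝ => |v (p.1 - p.2)| * U p.2 ^ (n + 1))
      (volume.prod volume) := integrable_convolve_integrand hv.abs hpow
  have i3 : Integrable (fun p : ℝ × ℝ => |v (p.1 - p.2)| * U p.1 ^ (n + 1))
      (volume.prod volume) := by
    have := (integrable_convolve_integrand hv.abs.comp_neg hpow).swap
    refine this.congr (ae_of_all _ fun p => ?_)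
    simp
  have e1 : ∫ x, U x ^ n * convolve v U x =
      ∫ p : ℝ × ℝ, U p.1 ^ n * (v (p.1 - p.2) * U p.2) ∂(volume.prod volume) := by
    rw [integral_prod _ i1]
    simp only [integral_const_mul, convolve]
  have e2 : ∫ p : ℝ × ℝ, |v (p.1 - p.2)| * U p.2 ^ (n + 1) ∂(volume.prod volume) =
      (∫ x, |v x|) * ∫ x, U x ^ (n + 1) := by
    rw [integral_prod_symm _ i2, ← integral_const_mul]
    refine integral_congr_ae (ae_of_all _ fun y => ?_)
    simp only [integral_mul_const]
    rw [integral_sub_right_eq_self (fun x => |v x|) y]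
  have e3 : ∫ p : ℝ × ℝ, |v (p.1 - p.2)| * U p.1 ^ (n + 1) ∂(volume.prod volume) =
      (∫ x, |v x|) * ∫ x, U x ^ (n + 1) := by
    rw [integral_prod _ i3, ← integral_const_mul]
    refine integral_congr_ae (ae_of_all _ fun y => ?_)
    simp only [integral_mul_const]
    rw [integral_sub_left_eq_self (fun x => |v x|) volume y]
  have hle : (n + 1) * ∫ x, U x ^ n * convolve v U x ≤
      n * ((∫ x, |v x|) * ∫ x, U x ^ (n + 1)) + (∫ x, |v x|) * ∫ x, U x ^ (n + 1) := by
    rw [e1, ← integral_const_mul]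
    nth_rewrite 1 [← e3]
    rw [← e2, ← integral_const_mul, ← integral_add (i3.const_mul _) i2]
    refine integral_mono (i1.const_mul _) ((i3.const_mul _).add i2) fun p => ?_
    have hy := mul_le_mul_of_nonneg_left (succ_mul_pow_mul_le (h0 p.1) (h0 p.2) n)
      (abs_nonneg (v (p.1 - p.2)))
    have hs : (n + 1 : ℝ) * (U p.1 ^ n * (v (p.1 - p.2) * U p.2)) ≤
        (n + 1) * (U p.1 ^ n * (|v (p.1 - p.2)| * U p.2)) := by
      gcongr
      · exact pow_nonneg (h0 _) _
      · exact h0 _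
      · exact le_abs_self _
    refine hs.trans (le_of_eq_of_le ?_ (hy.trans_eq ?_)) <;> ring
  have hn : (0 : ℝ) < n + 1 := by positivity
  refine le_of_mul_le_mul_left (hle.trans_eq ?_) hn
  ring

/-! ### The equation at a fixed time -/

/-- The flux `ε u_x + u (K' * u)` is absolutely continuous with derivative `u_t`. -/
theorem flux_ae_eq_integral {ε : ℝ} {u ux ut B b : ℝ → ℝ} {β : ℝ} (hu : Integrable u)
    (hux : Integrable ux) (hut : Integrable ut) (hd : HasWeakDeriv u ux) (hB : IsPrimitive B b β)
    (heq : ∀ φ, IsTestFunction φ →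
      ∫ x, ut x * φ x = ε * (∫ x, u x * deriv (deriv φ) x) - ∫ x, (u x * B x) * deriv φ x) :
    ∀ᵐ x, ε * ux x + u x * B x = ∫ y in Iic x, ut y := by
  have hW : Integrable fun x => ε * ux x + u x * B x :=
    (hux.const_mul ε).add (hB.integrable_mul' hu)
  refine HasWeakDeriv.ae_eq_integral ⟨hW.locallyIntegrable, hut.locallyIntegrable, ?_⟩ hW hut
  intro φ hφ
  have hp := hφ.deriv.isPrimitive
  rw [heq φ hφ, hd.2.2 _ hφ.deriv]
  have e : ∀ x, (ε * ux x + u x * B x) * deriv φ x =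
      ε * (ux x * deriv φ x) + (u x * B x) * deriv φ x := fun x => by ring
  simp only [e]
  rw [integral_add ((hp.integrable_mul' hux).const_mul ε)
    (hp.integrable_mul' (hB.integrable_mul' hu)), integral_const_mul]
  ring

/-- Conservation of mass: `∫ u_t = 0`. -/
theorem integral_timeDeriv_eq_zero {ε : ℝ} {u ux ut B b : ℝ → ℝ} {β : ℝ} (hu : Integrable u)
    (hux : Integrable ux) (hut : Integrable ut) (hd : HasWeakDeriv u ux) (hB : IsPrimitive B b β)
    (heq : ∀ φ, IsTestFunction φ →
      ∫ x, ut x * φ x = ε * (∫ x, u x * deriv (deriv φ) x) - ∫ x, (u x * B x) * deriv φ x) :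
    ∫ x, ut x = 0 :=
  (isPrimitive_integral_Iic hut).integral_eq_zero_of_integrable
    (((hux.const_mul ε).add (hB.integrable_mul' hu)).congr
      (flux_ae_eq_integral hu hux hut hd hB heq))

/-- The dissipation inequality for `∫ u ^ (n + 2)`: diffusion has a sign, and after two
integrations by parts the drift acts through the derivative `-A u + V_x * u` of the velocity. -/
theorem mul_integral_pow_mul_timeDeriv_le {ε A : ℝ} (hε : 0 ≤ ε) {u ux ut V v U : ℝ → ℝ}
    (hu : Integrable u) (hut : Integrable ut) (hU : IsPrimitive U ux 0)
    (huU : u =ᵐ[volume] U) (hd : HasWeakDeriv u ux) (h0 : ∀ x, 0 ≤ U x)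
    (hV : HasWeakDeriv V v) (hVi : Integrable V) (hv : Integrable v)
    (heq : ∀ φ, IsTestFunction φ →
      ∫ x, ut x * φ x = ε * (∫ x, u x * deriv (deriv φ) x) -
        ∫ x, (u x * convolve (interactionKernel A V) u x) * deriv φ x) (n : ℕ) :
    (n + 2) * ∫ x, U x ^ (n + 1) * ut x ≤
      -((n + 1) * ((A - ∫ x, |v x|) * ∫ x, U x ^ (n + 3))) := by
  have hux := hU.integrable
  have hUi : Integrable U := hu.congr huU
  have hB := isPrimitive_convolve_interactionKernel A hV hVi hv hu
  have hflux := flux_ae_eq_integral hu hux hut hd hB heq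
  set B := convolve (interactionKernel A V) u
  have hW := isPrimitive_integral_Iic hut
  set W : ℝ → ℝ := fun x => ∫ y in Iic x, ut y
  have hU1 := hU.pow_succ n
  have hU2 := hU.pow_succ (n + 1)
  have hM : ∀ x, U x ≤ ∫ y, |ux y| := fun x => by
    simpa using (le_abs_self _).trans (hU.abs_le x)
  have hpow : ∀ k : ℕ, Integrable fun x => U x ^ (k + 1) := fun k => by
    simp only [pow_succ]
    refine hUi.bdd_mul (c := (∫ y, |ux y|) ^ k) (hU.continuous.pow k).aestronglyMeasurable
      (ae_of_all _ fun x => ?_)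
    rw [norm_pow, Real.norm_of_nonneg (h0 x)]
    exact pow_le_pow_left₀ (h0 x) (hM x) k
  -- First integration by parts: `u_t` is the derivative of the flux `W`.
  have step1 : ∫ x, U x ^ (n + 1) * ut x = -((n + 1) * ∫ x, U x ^ n * ux x * W x) := by
    rw [hU1.integral_mul_eq_neg hW (hW.integrable_mul' (hpow n)), ← integral_const_mul]
    simp only [mul_assoc]
  have hUux : Integrable fun x => U x ^ n * ux x := by
    refine hux.bdd_mul (c := (∫ y, |ux y|) ^ n) (hU.continuous.pow n).aestronglyMeasurable
      (ae_of_all _ fun x => ?_)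
    rw [norm_pow, Real.norm_of_nonneg (h0 x)]
    exact pow_le_pow_left₀ (h0 x) (hM x) n
  have hUux1 : Integrable fun x => U x ^ (n + 1) * ux x := hU1.integrable_mul hux
  have step2 : ∫ x, U x ^ (n + 1) * ux x * B x ≤ ∫ x, U x ^ n * ux x * W x := by
    refine integral_mono_ae (hB.integrable_mul' hUux1) (hW.integrable_mul' hUux) ?_
    filter_upwards [hflux, huU] with x hx hxU
    have hWx : W x = ε * ux x + U x * B x := by rw [← hxU]; exact hx.symm
    have : 0 ≤ ε * (U x ^ n * (ux x * ux x)) :=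
      mul_nonneg hε (mul_nonneg (pow_nonneg (h0 x) n) (mul_self_nonneg _))
    rw [hWx]
    have e : U x ^ n * ux x * (ε * ux x + U x * B x) =
        ε * (U x ^ n * (ux x * ux x)) + U x ^ (n + 1) * ux x * B x := by ring
    linarith
  -- Second integration by parts, moving the derivative from `U ^ (n + 2)` to the velocity.
  have step3 : ∫ x, U x ^ (n + 2) * (-A * u x + convolve v u x) =
      -((n + 2) * ∫ x, U x ^ (n + 1) * ux x * B x) := by
    rw [hU2.integral_mul_eq_neg hB (hB.integrable_mul' (hpow (n + 1))), ← integral_const_mul]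
    push_cast
    congr 2 with x
    ring
  have step4 : ∫ x, U x ^ (n + 2) * (-A * u x + convolve v u x) ≤
      -((A - ∫ x, |v x|) * ∫ x, U x ^ (n + 3)) := by
    have hcv : convolve v u = convolve v U := convolve_congr_ae (EventuallyEq.refl _ _) huU
    have hci : Integrable fun x => U x ^ (n + 2) * convolve v U x :=
      hU2.integrable_mul (integrable_convolve hv hUi)
    have e : ∀ᵐ x, U x ^ (n + 2) * (-A * u x + convolve v u x) =
        -A * U x ^ (n + 3) + U x ^ (n + 2) * convolve v U x := by
      filter_upwards [huU] with x hx
      rw [hx, hcv]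
      ring
    rw [integral_congr_ae e, integral_add ((hpow (n + 2)).const_mul _) hci, integral_const_mul]
    have := integral_pow_mul_convolve_le hUi hU.continuous h0 hM hv (n + 2)
    linarith
  have hn1 : (0 : ℝ) ≤ n + 1 := by positivity
  have hn2 : (0 : ℝ) ≤ n + 2 := by positivity
  have a1 := mul_le_mul_of_nonneg_left step2 (mul_nonneg hn1 hn2)
  have a2 := mul_le_mul_of_nonneg_left step4 hn1
  rw [step3] at a2
  rw [step1]
  linarith

/-! ### Differentiation of the power integrals in time -/

/-- The map `L¹(ℝ) → C_b(ℝ)` sending `g` to its primitive `x ↦ ∫_{-∞}^x g`. -/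
noncomputable def primitiveCLM : L1 →L[ℝ] (ℝ →ᵇ ℝ) :=
  LinearMap.mkContinuous
    { toFun := fun g => BoundedContinuousFunction.ofNormedAddCommGroup
        (fun x => ∫ y in Iic x, g y)
        (isPrimitive_integral_Iic (L1.integrable_coeFn g)).continuous (∫ y, |g y|)
        (fun x => by simpa using (isPrimitive_integral_Iic (L1.integrable_coeFn g)).abs_le x)
      map_add' := fun f g => by
        ext x
        simp only [BoundedContinuousFunction.coe_ofNormedAddCommGroup,
          BoundedContinuousFunction.coe_add, Pi.add_apply]
        rw [← integral_add (L1.integrable_coeFn f).integrableOn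
          (L1.integrable_coeFn g).integrableOn]
        exact integral_congr_ae (ae_restrict_of_ae (Lp.coeFn_add f g))
      map_smul' := fun k g => by
        ext x
        simp only [BoundedContinuousFunction.coe_ofNormedAddCommGroup,
          BoundedContinuousFunction.coe_smul, RingHom.id_apply, smul_eq_mul]
        rw [← integral_const_mul]
        exact integral_congr_ae (ae_restrict_of_ae (Lp.coeFn_smul k g)) }
    1 fun g => by
      rw [one_mul, L1.norm_eq_integral_norm]
      exact (BoundedContinuousFunction.norm_le (integral_nonneg fun _ => norm_nonneg _)).2 fun x =>
        by simpa using (isPrimitive_integral_Iic (L1.integrable_coeFn g)).abs_le x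

theorem isPrimitive_primitiveCLM (g : L1) : IsPrimitive (primitiveCLM g) g 0 :=
  isPrimitive_integral_Iic (L1.integrable_coeFn g)

theorem integrable_bcf_mul (f : ℝ →ᵇ ℝ) {g : ℝ → ℝ} (hg : Integrable g) :
    Integrable fun x => f x * g x :=
  hg.bdd_mul f.continuous.aestronglyMeasurable (ae_of_all _ f.norm_coe_le_norm)

/-- The pairing `(f, g) ↦ ∫ f g` of `C_b(ℝ)` with `L¹(ℝ)`. -/
noncomputable def pairingCLM : (ℝ →ᵇ ℝ) →L[ℝ] L1 →L[ℝ] ℝ :=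
  LinearMap.mkContinuous₂
    (LinearMap.mk₂ ℝ (fun (f : ℝ →ᵇ ℝ) (g : L1) => ∫ x, f x * g x)
      (fun f f' g => by
        simp only [BoundedContinuousFunction.coe_add, Pi.add_apply, add_mul]
        exact integral_add (integrable_bcf_mul f (L1.integrable_coeFn g))
          (integrable_bcf_mul f' (L1.integrable_coeFn g)))
      (fun k f g => by
        simp only [BoundedContinuousFunction.coe_smul, smul_eq_mul, mul_assoc]
        exact integral_const_mul _ _)
      (fun f g g' => by
        rw [← integral_add (integrable_bcf_mul f (L1.integrable_coeFn g))
          (integrable_bcf_mul f (L1.integrable_coeFn g'))]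
        refine integral_congr_ae ?_
        filter_upwards [Lp.coeFn_add g g'] with x hx
        rw [hx, Pi.add_apply, mul_add])
      (fun k f g => by
        rw [smul_eq_mul, ← integral_const_mul]
        refine integral_congr_ae ?_
        filter_upwards [Lp.coeFn_smul k g] with x hx
        rw [hx, Pi.smul_apply, smul_eq_mul, mul_left_comm]))
    1 fun f g => by
      rw [one_mul, L1.norm_eq_integral_norm, ← integral_const_mul]
      refine (norm_integral_le_integral_norm _).trans
        (integral_mono (integrable_bcf_mul f (L1.integrable_coeFn g)).norm
          ((L1.integrable_coeFn g).norm.const_mul _) fun x => ?_)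
      simp only [norm_mul]
      exact mul_le_mul_of_nonneg_right (f.norm_coe_le_norm x) (norm_nonneg _)

theorem pairingCLM_apply (f : ℝ →ᵇ ℝ) (g : L1) : pairingCLM f g = ∫ x, f x * g x := rfl

/-- The chain rule for `∫ u ^ (n + 1)` along a curve that is differentiable in `L¹` and continuous
in `C_b`: the difference quotient is the pairing of a sum of products of powers, convergent in
`C_b`, with the difference quotient of the curve, convergent in `L¹`. -/
theorem hasDerivAt_integral_pow {u : ℝ → L1} {U : ℝ → ℝ →ᵇ ℝ} {s : Set ℝ} (hs : IsOpen s)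
    (hU : ContinuousOn U s) (huU : ∀ t ∈ s, u t =ᵐ[volume] U t) {t : ℝ} (ht : t ∈ s) {ut : L1}
    (hut : HasDerivAt u ut t) (n : ℕ) :
    HasDerivAt (fun r => ∫ x, U r x ^ (n + 1)) ((n + 1) * ∫ x, U t x ^ n * ut x) t := by
  rw [hasDerivAt_iff_tendsto_slope] at hut ⊢
  have hUt : Tendsto U (𝓝[≠] t) (𝓝 (U t)) :=
    ((hU.continuousAt (hs.mem_nhds ht)).tendsto).mono_left nhdsWithin_le_nhds
  have hQ : Tendsto (fun r => ∑ i ∈ Finset.range (n + 1), U r ^ i * U t ^ (n + 1 - 1 - i))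
      (𝓝[≠] t) (𝓝 (∑ i ∈ Finset.range (n + 1), U t ^ i * U t ^ (n + 1 - 1 - i))) :=
    tendsto_finsetSum _ fun i _ => (hUt.pow i).mul tendsto_const_nhds
  have hlim := (pairingCLM.isBoundedBilinearMap.continuous.tendsto (_, _)).comp
    (hQ.prodMk_nhds hut)
  have hval : pairingCLM (∑ i ∈ Finset.range (n + 1), U t ^ i * U t ^ (n + 1 - 1 - i)) ut =
      (n + 1) * ∫ x, U t x ^ n * ut x := by
    have : ∑ i ∈ Finset.range (n + 1), U t ^ i * U t ^ (n + 1 - 1 - i) =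
        ((n : ℝ) + 1) • U t ^ n := by
      rw [Finset.sum_congr rfl (g := fun _ => U t ^ n)]
      · rw [Finset.sum_const, Finset.card_range, ← Nat.cast_smul_eq_nsmul ℝ]
        push_cast
        rfl
      · intro i hi
        rw [← pow_add]
        congr 1
        have := Finset.mem_range.1 hi
        omega
    rw [this, map_smul, _root_.smul_apply, smul_eq_mul, pairingCLM_apply]
    rfl
  have hInt : ∀ r ∈ s, Integrable fun x => U r x ^ (n + 1) := fun r hr => by
    have := integrable_bcf_mul (U r ^ n) ((L1.integrable_coeFn (u r)).congr (huU r hr))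
    simpa only [BoundedContinuousFunction.coe_pow, Pi.pow_apply, ← pow_succ] using this
  rw [← hval]
  refine hlim.congr' ?_
  filter_upwards [nhdsWithin_le_nhds (hs.mem_nhds ht)] with r hr
  simp only [Function.comp_apply, slope_def_module]
  rw [map_smul, pairingCLM_apply]
  congr 1
  rw [← integral_sub (hInt r hr) (hInt t ht)]
  refine integral_congr_ae ?_
  filter_upwards [Lp.coeFn_sub (u r) (u t), huU r hr, huU t ht] with x h1 h2 h3
  rw [h1, Pi.sub_apply, h2, h3, ← geom_sum₂_mul (U r x) (U t x) (n + 1)]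
  simp

/-! ### The differential inequality and the limit of large exponents -/

/-- Comparison for the power integrals. With `c = A - ‖V_x‖₁`, `y t = ∫ u ^ (n + 1)` and
`z t = ∫ u ^ (n + 2)`, Young's inequality makes `c ^ n (t - t₀) ^ (n + 1) y t` grow at rate at most
the mass `M`, so no interpolation between `y` and `z` is needed. -/
theorem pow_mul_integral_pow_le {U : ℝ → ℝ → ℝ} {y' : ℝ → ℝ} {c M t₀ t : ℝ} (n : ℕ)
    (hc : 0 < c) (ht : t₀ < t) (hnonneg : ∀ s ∈ Icc t₀ t, ∀ x, 0 ≤ U s x)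
    (hint : ∀ s ∈ Icc t₀ t, ∀ k : ℕ, Integrable fun x => U s x ^ (k + 1))
    (hmass : ∀ s ∈ Icc t₀ t, ∫ x, U s x ≤ M)
    (hderiv : ∀ s ∈ Icc t₀ t, HasDerivAt (fun r => ∫ x, U r x ^ (n + 1)) (y' s) s)
    (hle : ∀ s ∈ Icc t₀ t, y' s ≤ -(n * (c * ∫ x, U s x ^ (n + 2)))) :
    (c * (t - t₀)) ^ n * ∫ x, U t x ^ (n + 1) ≤ M := by
  set y : ℝ → ℝ := fun r => ∫ x, U r x ^ (n + 1) with hy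
  set G : ℝ → ℝ := fun s => c ^ n * ((s - t₀) ^ (n + 1) * y s) with hG
  set G' : ℝ → ℝ := fun s => c ^ n * ((n + 1) * (s - t₀) ^ n * y s + (s - t₀) ^ (n + 1) * y' s)
    with hG'
  have hGd : ∀ s ∈ Icc t₀ t, HasDerivAt G (G' s) s := fun s hs => by
    have h1 : HasDerivAt (fun s => (s - t₀) ^ (n + 1)) ((n + 1) * (s - t₀) ^ n) s := by
      simpa using ((hasDerivAt_id s).sub_const t₀).fun_pow (n + 1)
    exact (h1.mul (hderiv s hs)).const_mul _
  have hbound : ∀ s ∈ Icc t₀ t, G' s ≤ M := fun s hs => by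
    have hτ : 0 ≤ s - t₀ := sub_nonneg.2 hs.1
    have h1 : G' s ≤ c ^ n * ((n + 1) * (s - t₀) ^ n * y s +
        (s - t₀) ^ (n + 1) * -(n * (c * ∫ x, U s x ^ (n + 2)))) := by
      have := hle s hs
      simp only [hG']
      gcongr
    refine h1.trans (le_trans ?_ (hmass s hs))
    have e : c ^ n * ((n + 1) * (s - t₀) ^ n * y s +
        (s - t₀) ^ (n + 1) * -(n * (c * ∫ x, U s x ^ (n + 2)))) =
        ∫ x, ((n + 1) * (c * (s - t₀)) ^ n * U s x ^ (n + 1) -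
          n * (c * (s - t₀)) ^ (n + 1) * U s x ^ (n + 2)) := by
      rw [integral_sub ((hint s hs n).const_mul _) ((hint s hs (n + 1)).const_mul _),
        integral_const_mul, integral_const_mul, hy]
      simp only [mul_pow]
      ring
    rw [e]
    refine integral_mono (((hint s hs n).const_mul _).sub ((hint s hs (n + 1)).const_mul _))
      (by simpa using hint s hs 0) fun x => ?_
    have hx := hnonneg s hs x
    have hyoung := mul_le_mul_of_nonneg_left (succ_mul_pow_mul_le
      (mul_nonneg (mul_nonneg hc.le hτ) hx) zero_le_one n) hx
    rw [mul_one, one_pow] at hyoung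
    simp only
    have e1 : U s x * ((n + 1) * (c * (s - t₀) * U s x) ^ n) =
      (n + 1) * (c * (s - t₀)) ^ n * U s x ^ (n + 1) := by
      simp only [mul_pow]
      ring
    have e2 : U s x * (n * (c * (s - t₀) * U s x) ^ (n + 1) + 1) =
      n * (c * (s - t₀)) ^ (n + 1) * U s x ^ (n + 2) + U s x := by
      simp only [mul_pow]
      ring
    linarith
  have hcomp := image_le_of_deriv_right_le_deriv_boundary (f := G) (f' := G') (a := t₀) (b := t)
    (B := fun s => M * (s - t₀)) (B' := fun _ => M)
    (fun s hs => (hGd s hs).continuousAt.continuousWithinAt)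
    (fun s hs => (hGd s (Ico_subset_Icc_self hs)).hasDerivWithinAt)
    (by simp [hG]) (by fun_prop)
    (fun s _ => by simpa using (((hasDerivAt_id s).sub_const t₀).const_mul M).hasDerivWithinAt)
    (fun s hs => hbound s (Ico_subset_Icc_self hs)) (right_mem_Icc.2 ht.le)
  refine le_of_mul_le_mul_right (le_of_eq_of_le ?_ hcomp) (sub_pos.2 ht)
  simp only [hG, hy, mul_pow]
  ring

/-- If the moments `∫ U (k U) ^ n` stay bounded as `n → ∞`, then `k U ≤ 1`. -/
theorem mul_le_one_of_integral_pow_le {U : ℝ → ℝ} {k M : ℝ} (hk : 0 < k) (hc : Continuous U)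
    (h0 : ∀ x, 0 ≤ U x) (hint : ∀ n : ℕ, Integrable fun x => U x ^ (n + 1))
    (h : ∀ n : ℕ, 1 ≤ n → k ^ n * ∫ x, U x ^ (n + 1) ≤ M) (x : ℝ) : k * U x ≤ 1 := by
  by_contra! hx
  obtain ⟨q, hq1, hqx⟩ := exists_between hx
  have hUi : Integrable U := by simpa using hint 0
  set E : Set ℝ := {z | q < k * U z}
  have hE : IsOpen E := isOpen_lt continuous_const (continuous_const.mul hc)
  have hpos : 0 < ∫ z in E, U z := by
    rw [setIntegral_pos_iff_support_of_nonneg_ae (ae_of_all _ h0) hUi.integrableOn]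
    have hsub : E ⊆ Function.support U := fun z hz hz0 => by
      have : q < k * U z := hz
      rw [hz0, mul_zero] at this
      linarith
    rw [inter_eq_right.2 hsub]
    exact hE.measure_pos volume ⟨x, hqx⟩
  obtain ⟨n, hn⟩ := pow_unbounded_of_one_lt (M / ∫ z in E, U z) hq1
  have hlow : q ^ (n + 1) * ∫ z in E, U z ≤ k ^ (n + 1) * ∫ z, U z ^ (n + 1 + 1) := by
    rw [← integral_const_mul, ← integral_const_mul]
    refine le_trans ?_ (setIntegral_le_integral ((hint (n + 1)).const_mul _)
      (ae_of_all _ fun z => mul_nonneg (pow_nonneg hk.le _) (pow_nonneg (h0 z) _)) (s := E))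
    refine setIntegral_mono_on (hUi.const_mul _).integrableOn
      ((hint (n + 1)).const_mul _).integrableOn hE.measurableSet fun z hz => ?_
    have := pow_le_pow_left₀ (zero_le_one.trans hq1.le) (le_of_lt (show q < k * U z from hz))
      (n + 1)
    calc q ^ (n + 1) * U z ≤ (k * U z) ^ (n + 1) * U z := mul_le_mul_of_nonneg_right this (h0 z)
      _ = k ^ (n + 1) * U z ^ (n + 1 + 1) := by ring
  have hM := hlow.trans (h (n + 1) (by omega))
  rw [div_lt_iff₀ hpos] at hn
  have := mul_le_mul_of_nonneg_right (pow_le_pow_right₀ hq1.le (Nat.le_succ n)) hpos.le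
  exact absurd (hn.trans_le (this.trans hM)) (lt_irrefl _)

/-! ### Estimates for the solution -/

section Solution

variable {ε A : ℝ} {V Vx u₀ : L1} {u : ℝ → L1}

theorem IsAggregationSolution.hasDerivAt {K' : ℝ → ℝ} (hu : IsAggregationSolution ε K' u₀ u)
    {t : ℝ} (ht : 0 < t) : HasDerivAt u (deriv u t) t :=
  ((hu.contDiff_L1.differentiableOn one_ne_zero).differentiableAt (Ioi_mem_nhds ht)).hasDerivAt

/-- The mass of the solution does not exceed the norm of the initial datum. -/
theorem IsAggregationSolution.integral_le (hV : HasWeakDeriv V Vx)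
    (hu : IsAggregationSolution ε (interactionKernel A V) u₀ u) {t : ℝ} (ht : 0 < t) :
    ∫ x, u t x ≤ ‖u₀‖ := by
  obtain ⟨ux, -, hux⟩ := hu.continuous_W11
  have hI : ∀ f : L1, L1.integralCLM f = ∫ x, f x := fun f => by
    rw [← L1.integral_eq_integral, L1.integral_eq]
  have hd : ∀ s, 0 < s → HasDerivAt (fun s => L1.integralCLM (u s)) 0 s := fun s hs => by
    have h := (L1.integralCLM (α := ℝ) (E := ℝ) (μ := volume)).hasFDerivAt.comp_hasDerivAt s
      (hu.hasDerivAt hs)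
    rwa [hI, integral_timeDeriv_eq_zero (L1.integrable_coeFn _) (L1.integrable_coeFn (ux s))
      (L1.integrable_coeFn _) (hux s hs)
      (isPrimitive_convolve_interactionKernel A hV (L1.integrable_coeFn V)
        (L1.integrable_coeFn Vx) (L1.integrable_coeFn (u s))) (hu.equation s hs)] at h
  have hanti : AntitoneOn (fun s => L1.integralCLM (u s)) (Ici (0 : ℝ)) := by
    refine antitoneOn_of_deriv_nonpos (convex_Ici 0)
      (L1.integralCLM.continuous.comp_continuousOn hu.continuous_L1) ?_ ?_
    · rw [interior_Ici]
      exact fun s hs => (hd s hs).differentiableAt.differentiableWithinAt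
    · rw [interior_Ici]
      exact fun s hs => (hd s hs).deriv.le
  have h := hanti (mem_Ici.2 le_rfl) (mem_Ici.2 ht.le) ht.le
  simp only [hI, hu.initial] at h
  rw [L1.norm_eq_integral_norm]
  exact h.trans (integral_mono (L1.integrable_coeFn _) (L1.integrable_coeFn _).norm
    fun x => le_abs_self _)

/-- The decay of the supremum of the solution. -/
theorem IsAggregationSolution.ae_le (hε : 0 < ε) (hV : HasWeakDeriv V Vx) (hVx : ‖Vx‖ < A)
    (hu : IsAggregationSolution ε (interactionKernel A V) u₀ u)
    (hnonneg : ∀ t : ℝ, 0 < t → ∀ᵐ x : ℝ, 0 ≤ u t x) {t : ℝ} (ht : 0 < t) :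
    ∀ᵐ x, u t x ≤ (A - ‖Vx‖)⁻¹ * t⁻¹ := by
  obtain ⟨ux, huxc, hux⟩ := hu.continuous_W11
  have hc : 0 < A - ‖Vx‖ := sub_pos.2 hVx
  let U : ℝ → ℝ →ᵇ ℝ := fun s => primitiveCLM (ux s)
  have hUc : ContinuousOn U (Ioi 0) := primitiveCLM.continuous.comp_continuousOn huxc
  have hP : ∀ s, IsPrimitive (U s) (ux s) 0 := fun s => isPrimitive_primitiveCLM (ux s)
  have huU : ∀ s ∈ Ioi (0 : ℝ), u s =ᵐ[volume] U s := fun s hs =>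
    (hux s hs).ae_eq_integral (L1.integrable_coeFn _) (L1.integrable_coeFn _)
  have hU0 : ∀ s, 0 < s → ∀ x, 0 ≤ U s x := fun s hs x => by
    have hmax : U s =ᵐ[volume] fun x => max (U s x) 0 := by
      filter_upwards [hnonneg s hs, huU s hs] with x h1 h2
      rw [← h2, max_eq_left h1]
    rw [Continuous.ae_eq_iff_eq (volume : Measure ℝ) (U s).continuous
      ((U s).continuous.max continuous_const)] at hmax
    rw [hmax]
    exact le_max_right _ _
  have hUint : ∀ s, 0 < s → ∀ k : ℕ, Integrable fun x => U s x ^ (k + 1) := fun s hs k => by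
    have := integrable_bcf_mul (U s ^ k) ((L1.integrable_coeFn (u s)).congr (huU s hs))
    simpa only [BoundedContinuousFunction.coe_pow, Pi.pow_apply, ← pow_succ] using this
  have hnorm : ∫ x, |Vx x| = ‖Vx‖ := (L1.norm_eq_integral_norm Vx).symm
  have hdecay : ∀ t₀, 0 < t₀ → t₀ < t → ∀ x, (A - ‖Vx‖) * (t - t₀) * U t x ≤ 1 := by
    intro t₀ ht₀ htt
    have hpos : ∀ s ∈ Icc t₀ t, 0 < s := fun s hs => ht₀.trans_le hs.1
    refine mul_le_one_of_integral_pow_le (M := ‖u₀‖) (mul_pos hc (sub_pos.2 htt))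
      (U t).continuous (hU0 t ht) (hUint t ht) fun n hn => ?_
    obtain ⟨m, rfl⟩ := Nat.exists_eq_add_of_le' hn
    refine pow_mul_integral_pow_le (U := fun s x => U s x)
      (y' := fun s => ((m + 1 : ℕ) + 1) * ∫ x, U s x ^ (m + 1) * deriv u s x) (m + 1) hc htt
      (fun s hs => hU0 s (hpos s hs)) (fun s hs => hUint s (hpos s hs)) (fun s hs => ?_)
      (fun s hs => hasDerivAt_integral_pow isOpen_Ioi hUc huU (hpos s hs)
        (hu.hasDerivAt (hpos s hs)) (m + 1)) (fun s hs => ?_)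
    · rw [← integral_congr_ae (huU s (hpos s hs))]
      exact hu.integral_le hV (hpos s hs)
    · have h := mul_integral_pow_mul_timeDeriv_le hε.le (L1.integrable_coeFn (u s))
        (L1.integrable_coeFn (deriv u s)) (hP s) (huU s (hpos s hs)) (hux s (hpos s hs))
        (hU0 s (hpos s hs)) hV (L1.integrable_coeFn V) (L1.integrable_coeFn Vx)
        (hu.equation s (hpos s hs)) m
      rw [hnorm] at h
      push_cast
      refine le_of_eq_of_le ?_ h
      ring
  filter_upwards [huU t ht] with x hx
  -- The initial time `t₀ > 0` was arbitrary; let it tend to zero.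
  have hlim : Tendsto (fun t₀ => (A - ‖Vx‖) * (t - t₀) * U t x) (𝓝[>] 0)
      (𝓝 ((A - ‖Vx‖) * (t - 0) * U t x)) :=
    (Continuous.tendsto (by fun_prop) 0).mono_left nhdsWithin_le_nhds
  have hle : (A - ‖Vx‖) * (t - 0) * U t x ≤ 1 := by
    refine le_of_tendsto hlim ?_
    filter_upwards [Ioo_mem_nhdsGT ht] with t₀ h₀ using hdecay t₀ h₀.1 h₀.2 x
  rw [hx, ← mul_inv, ← one_div, le_div_iff₀' (mul_pos hc ht)]
  simpa using hle

end Solution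

/-- Interpolation of `Lᵖ` between `L¹` and `L^∞`. -/
theorem eLpNorm_le_of_integral_le_of_ae_le {f : ℝ → ℝ} (hf : Integrable f)
    (h0 : ∀ᵐ x, 0 ≤ f x) {M K : ℝ} (hK : 0 ≤ K) (hM : ∫ x, f x ≤ M)
    (hfK : ∀ᵐ x, f x ≤ K) {p : ℝ} (hp : 1 ≤ p) :
    eLpNorm f (ENNReal.ofReal p) volume ≤
      ENNReal.ofReal (K ^ ((p - 1) / p) * M ^ (1 / p)) := by
  have hp0 : 0 < p := zero_lt_one.trans_le hp
  have hM0 : 0 ≤ M := (integral_nonneg_of_ae h0).trans hM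
  rw [eLpNorm_eq_lintegral_rpow_enorm_toReal (by simpa using hp0) ENNReal.ofReal_ne_top,
    ENNReal.toReal_ofReal hp0.le]
  have h1 : ∫⁻ x, ‖f x‖ₑ ^ p ≤ ENNReal.ofReal (K ^ (p - 1) * M) := by
    calc ∫⁻ x, ‖f x‖ₑ ^ p ≤ ∫⁻ x, ENNReal.ofReal (K ^ (p - 1)) * ENNReal.ofReal (f x) := by
          refine lintegral_mono_ae ?_
          filter_upwards [h0, hfK] with x hx hxK
          rw [Real.enorm_of_nonneg hx, ENNReal.ofReal_rpow_of_nonneg hx hp0.le,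
            ← ENNReal.ofReal_mul (Real.rpow_nonneg hK _)]
          refine ENNReal.ofReal_le_ofReal ?_
          calc f x ^ p = f x ^ (p - 1) * f x := by
                rcases hx.eq_or_lt with h | h
                · rw [← h, Real.zero_rpow hp0.ne', mul_zero]
                · rw [Real.rpow_sub_one h.ne', div_mul_cancel₀ _ h.ne']
            _ ≤ K ^ (p - 1) * f x := by
                have := Real.rpow_le_rpow hx hxK (sub_nonneg.2 hp)
                gcongr
      _ = ENNReal.ofReal (K ^ (p - 1)) * ENNReal.ofReal (∫ x, f x) := by
          rw [lintegral_const_mul' _ _ ENNReal.ofReal_ne_top,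
            ofReal_integral_eq_lintegral_ofReal hf h0]
      _ ≤ ENNReal.ofReal (K ^ (p - 1) * M) := by
          rw [← ENNReal.ofReal_mul (Real.rpow_nonneg hK _)]
          gcongr
  calc (∫⁻ x, ‖f x‖ₑ ^ p) ^ (1 / p) ≤ ENNReal.ofReal (K ^ (p - 1) * M) ^ (1 / p) := by
        gcongr
    _ = ENNReal.ofReal (K ^ ((p - 1) / p) * M ^ (1 / p)) := by
        rw [ENNReal.ofReal_rpow_of_nonneg (mul_nonneg (Real.rpow_nonneg hK _) hM0) (by positivity),
          Real.mul_rpow (Real.rpow_nonneg hK _) hM0, ← Real.rpow_mul hK, mul_one_div]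

theorem mainTheorem1 (ε A : ℝ) (hε : 0 < ε) (hA : 0 < A)
    (V Vx : L1) (hV : HasWeakDeriv V Vx) (hVx : ‖Vx‖ < A)
    (u₀ : L1) (hu₀ : ∀ᵐ x : ℝ, 0 ≤ u₀ x)
    (u : ℝ → L1) (hu : IsAggregationSolution ε (interactionKernel A V) u₀ u)
    (hu_nonneg : ∀ t : ℝ, 0 < t → ∀ᵐ x : ℝ, 0 ≤ u t x) :
    (∀ p : ℝ, 1 ≤ p → ∀ t : ℝ, 0 < t →
      eLpNorm (u t) (ENNReal.ofReal p) volume ≤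
        ENNReal.ofReal ((A - ‖Vx‖) ^ ((1 - p) / p) * ‖u₀‖ ^ (1 / p) * t ^ ((1 - p) / p))) ∧
    (∀ t : ℝ, 0 < t →
      eLpNorm (u t) ∞ volume ≤ ENNReal.ofReal ((A - ‖Vx‖)⁻¹ * t⁻¹)) := by
  have hc : 0 < A - ‖Vx‖ := sub_pos.2 hVx
  refine ⟨fun p hp t ht => ?_, fun t ht => ?_⟩
  · have hK : 0 ≤ (A - ‖Vx‖)⁻¹ * t⁻¹ := by positivity
    refine (eLpNorm_le_of_integral_le_of_ae_le (L1.integrable_coeFn (u t)) (hu_nonneg t ht) hK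
      (hu.integral_le hV ht) (hu.ae_le hε hV hVx hu_nonneg ht) hp).trans_eq ?_
    have e : (1 - p) / p = -((p - 1) / p) := by ring
    rw [e, Real.mul_rpow (inv_nonneg.2 hc.le) (inv_nonneg.2 ht.le), Real.rpow_neg hc.le,
      Real.rpow_neg ht.le, Real.inv_rpow hc.le, Real.inv_rpow ht.le]
    congr 1
    ring
  · rw [eLpNorm_exponent_top]
    refine eLpNormEssSup_le_of_ae_bound ?_
    filter_upwards [hu_nonneg t ht, hu.ae_le hε hV hVx hu_nonneg ht] with x h1 h2
    rwa [Real.norm_of_nonneg h1]
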